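/- A polynomial $f\in\mathbb{R}[x]$ is called hyperbolic if all of its complex zeros are real; the zero polynomial is also deemed hyperbolic. A linear operator $T:\mathbb{R}[x]\to\mathbb{R}[x]$ preserves hyperbolicity if $T[f]$ is hyperbolic whenever $f$ is hyperbolic. Let $D=\frac{d}{dx}$. Theorem. Let $r,c_0,c_1,c_2\in\mathbb{R}$ with $c_2\neq 0$, and let $Q_0(x)=c_0$, $Q_1(x)=c_1(x-r)$, $Q_2(x)=c_2(x-r)^2$. Then $$0\le \tfrac14 c_1^2-c_0c_2$$ and $c_0,c_1,c_2$ are of the same sign (that is, all three are $\ge 0$ or all three are $\le 0$) if and only if the operator $$T=Q_2(x)D^2+Q_1(x)D+Q_0(x)$$ preserves hyperbolicity. -/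

import Mathlib

open scoped Polynomial

/-- A real polynomial is hyperbolic if all its complex zeros are real; by convention the zero
polynomial is hyperbolic too. -/
def IsHyperbolic (f : ℝ[X]) : Prop :=
  f = 0 ∨ ∀ z : ℂ, Polynomial.aeval z f = 0 → z.im = 0

/-- A linear operator on real polynomials preserves hyperbolicity if it maps hyperbolic
polynomials to hyperbolic polynomials. -/
def PreservesHyperbolicity (T : ℝ[X] →ₗ[ℝ] ℝ[X]) : Prop :=
  ∀ f : ℝ[X], IsHyperbolic f → IsHyperbolic (T f)

/-- The differential operator `Q₂ D² + Q₁ D + Q₀` on real polynomials, where `D = d/dx`. -/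
noncomputable def diffOp (Q₂ Q₁ Q₀ : ℝ[X]) : ℝ[X] →ₗ[ℝ] ℝ[X] :=
  LinearMap.mulLeft ℝ Q₂ ∘ₗ Polynomial.derivative ∘ₗ Polynomial.derivative
    + LinearMap.mulLeft ℝ Q₁ ∘ₗ Polynomial.derivative
    + LinearMap.mulLeft ℝ Q₀

/-- Three real numbers are of the same sign, zero being compatible with either sign: all are
nonnegative or all are nonpositive. -/
def SameSign (a b c : ℝ) : Prop :=
  (0 ≤ a ∧ 0 ≤ b ∧ 0 ≤ c) ∨ (a ≤ 0 ∧ b ≤ 0 ∧ c ≤ 0)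

open Polynomial

/-! ### Complex numbers with positive real part -/

/-! Sufficiency: write `c₁ = c₂(a + b)`, `c₀ = c₂ab` with `a, b ≥ 0`. At a nonreal zero `z` of `T
f`, dividing by `c₂ (z - r)² f(z)` gives `(S + a/(z - r)) (S + b/(z - r)) = ∑ (z - α)⁻²`, with `α`
over the roots of `f` and `S = ∑ (z - α)⁻¹`. Multiplication by `i · Im z` moves every `(z - α)⁻¹`
into the right half-plane, where `Complex.eq_zero_or_card_eq_one_of_mul_eq_sum_sq` leaves only cases
with `T f = 0`.

Necessity: `T` acts on `(x - r)ⁿ` by an eigenvalue `λₙ` quadratic in `n`. Testing on `(x - r)^(k+2)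
- (x - r)^k` gives `λₖ λₖ₊₂ ≥ 0`, which controls signs; testing on high powers of `x - r + 1` gives
the discriminant inequality. -/

theorem Multiset.sum_sq_le_sq_sum {ι : Type*} (t : Multiset ι) (x : ι → ℝ)
    (hx : ∀ w ∈ t, 0 < x w) :
    0 ≤ (t.map x).sum ∧ (t.map fun w => x w ^ 2).sum ≤ (t.map x).sum ^ 2 := by
  induction t using Multiset.induction with
  | empty => simp
  | cons a t ih =>
    obtain ⟨h1, h2⟩ := ih fun w hw => hx w (Multiset.mem_cons_of_mem hw)
    have ha := hx a (Multiset.mem_cons_self a t)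
    simp only [Multiset.map_cons, Multiset.sum_cons]
    exact ⟨by positivity, by nlinarith [mul_nonneg ha.le h1]⟩

theorem Multiset.sum_sq_lt_sq_sum {ι : Type*} (t : Multiset ι) (x : ι → ℝ)
    (hx : ∀ w ∈ t, 0 < x w) (ht : 2 ≤ t.card) :
    (t.map fun w => x w ^ 2).sum < (t.map x).sum ^ 2 := by
  induction t using Multiset.induction with
  | empty => simp at ht
  | cons a t _ =>
    obtain ⟨b, hb⟩ : ∃ b, b ∈ t := Multiset.card_pos_iff_exists_mem.1 (by simp at ht; omega)
    obtain ⟨u, rfl⟩ := Multiset.exists_cons_of_mem hb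
    obtain ⟨h1, h2⟩ := Multiset.sum_sq_le_sq_sum u x fun w hw => hx w (by simp [hw])
    have ha := hx a (by simp)
    have hb := hx b (by simp)
    simp only [Multiset.map_cons, Multiset.sum_cons]
    nlinarith [mul_nonneg ha.le h1, mul_nonneg hb.le h1, mul_pos ha hb]

theorem Complex.norm_sq_add_re_sq (w : ℂ) : ‖w ^ 2‖ + (w ^ 2).re = 2 * w.re ^ 2 := by
  rw [norm_pow, Complex.sq_norm, Complex.normSq_apply, sq w, Complex.mul_re]
  ring

/-- The function `ζ ↦ ‖ζ‖ + Re ζ` is subadditive and equals `2 (Re w)²` at `ζ = w²`. -/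
theorem Complex.norm_add_re_sum_sq_le (t : Multiset ℂ) :
    ‖(t.map fun w => w ^ 2).sum‖ + ((t.map fun w => w ^ 2).sum).re
      ≤ 2 * (t.map fun w => w.re ^ 2).sum := by
  induction t using Multiset.induction with
  | empty => simp
  | cons a t ih =>
    simp only [Multiset.map_cons, Multiset.sum_cons, Complex.add_re]
    have := norm_add_le (a ^ 2) (t.map fun w => w ^ 2).sum
    have := Complex.norm_sq_add_re_sq a
    linarith

theorem Complex.two_mul_re_mul_re_le (A B : ℂ) : 2 * (A.re * B.re) ≤ ‖A * B‖ + (A * B).re := by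
  -- The left side is the real part of `A` times the conjugate of `B`, which has the same norm as `A
  -- * B`.
  have h : A.re * B.re + A.im * B.im ≤ ‖A * B‖ := by
    have h := Complex.re_le_norm (A * (starRingEnd ℂ) B)
    rw [norm_mul, Complex.norm_conj, ← norm_mul] at h
    simpa using h
  rw [Complex.mul_re]
  linarith

theorem Complex.re_multiset_sum (t : Multiset ℂ) : t.sum.re = (t.map Complex.re).sum := by
  induction t using Multiset.induction with
  | empty => simp
  | cons a t ih => simp [ih]

/-- A quantitative form of the Grace-Walsh-Szegő argument for `(s + p) (s + q) - ∑ w²`. -/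
theorem Complex.eq_zero_or_card_eq_one_of_mul_eq_sum_sq (t : Multiset ℂ)
    (ht : ∀ w ∈ t, 0 < w.re) (p q : ℂ) (hp : 0 ≤ p.re) (hq : 0 ≤ q.re)
    (h : (t.sum + p) * (t.sum + q) = (t.map fun w => w ^ 2).sum) :
    t = 0 ∨ t.card = 1 ∧ p.re = 0 ∧ q.re = 0 := by
  have h1 := Complex.two_mul_re_mul_re_le (t.sum + p) (t.sum + q)
  rw [h] at h1
  have h2 := h1.trans (Complex.norm_add_re_sum_sq_le t)
  simp only [Complex.add_re, Complex.re_multiset_sum] at h2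
  obtain ⟨h3, h4⟩ := Multiset.sum_sq_le_sq_sum t Complex.re ht
  set X := (t.map Complex.re).sum with hX
  rcases Nat.lt_or_ge t.card 2 with hc | hc
  · rcases Nat.eq_zero_or_pos t.card with h0 | h0
    · exact Or.inl (Multiset.card_eq_zero.1 h0)
    · have hc1 : t.card = 1 := by omega
      obtain ⟨a, rfl⟩ := Multiset.card_eq_one.1 hc1
      have ha : 0 < X := by simpa [hX] using ht a (by simp)
      have := mul_nonneg hp hq
      have := mul_nonneg hp ha.le
      have := mul_nonneg hq ha.le
      refine Or.inr ⟨hc1, ?_, ?_⟩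
      · have : p.re * X = 0 := by nlinarith
        simpa [ha.ne'] using this
      · have : q.re * X = 0 := by nlinarith
        simpa [ha.ne'] using this
  · have := Multiset.sum_sq_lt_sq_sum t Complex.re ht hc
    have := mul_nonneg hp hq
    have := mul_nonneg hp h3
    have := mul_nonneg hq h3
    nlinarith

/-! ### Logarithmic derivatives -/

theorem Polynomial.eval_derivative_multiset_prod_X_sub_C {K : Type*} [Field K] (s : Multiset K)
    (z : K) (hz : z ∉ s) :
    (derivative (s.map fun a => X - C a).prod).eval z =
        (s.map fun a => X - C a).prod.eval z * (s.map fun a => (z - a)⁻¹).sum ∧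
    (derivative (derivative (s.map fun a => X - C a).prod)).eval z =
        (s.map fun a => X - C a).prod.eval z *
          ((s.map fun a => (z - a)⁻¹).sum ^ 2 - (s.map fun a => (z - a)⁻¹ ^ 2).sum) := by
  induction s using Multiset.induction with
  | empty => simp
  | cons a s ih =>
    simp only [Multiset.mem_cons, not_or] at hz
    obtain ⟨h1, h2⟩ := ih hz.2
    have ha : z - a ≠ 0 := sub_ne_zero.2 hz.1
    simp only [Multiset.map_cons, Multiset.prod_cons, Multiset.sum_cons, derivative_mul,
      derivative_add, derivative_sub, derivative_X, derivative_C, eval_add, eval_mul,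
      eval_sub, eval_X, eval_C, h1, h2, sub_zero, one_mul]
    constructor
    · field_simp
    · field_simp
      ring

/-! ### The operator -/

theorem diffOp_apply (Q₂ Q₁ Q₀ f : ℝ[X]) : diffOp Q₂ Q₁ Q₀ f =
    Q₂ * derivative (derivative f) + Q₁ * derivative f + Q₀ * f := by
  simp [diffOp]

/-- The Euler operator `c₂ (x - r)² D² + c₁ (x - r) D + c₀`. -/
noncomputable def eulerOp (r c₀ c₁ c₂ : ℝ) : ℝ[X] →ₗ[ℝ] ℝ[X] :=
  diffOp (C c₂ * (X - C r) ^ 2) (C c₁ * (X - C r)) (C c₀)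

/-- The eigenvalue of the Euler operator on `(x - r) ^ n`. -/
def eulerEigenvalue (c₀ c₁ c₂ : ℝ) (n : ℕ) : ℝ :=
  c₂ * (n * (n - 1)) + c₁ * n + c₀

theorem eulerOp_X_sub_C_pow (r c₀ c₁ c₂ : ℝ) (n : ℕ) :
    eulerOp r c₀ c₁ c₂ ((X - C r) ^ n) = C (eulerEigenvalue c₀ c₁ c₂ n) * (X - C r) ^ n := by
  rw [eulerOp, diffOp_apply, eulerEigenvalue]
  rcases n with _ | _ | n
  · simp
  · simp
    ring
  · simp [derivative_X_sub_C_pow]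
    ring

theorem exists_factor_of_sameSign {c₀ c₁ c₂ : ℝ} (hc₂ : c₂ ≠ 0)
    (hd : 0 ≤ c₁ ^ 2 * (1 / 4) - c₀ * c₂) (hs : SameSign c₀ c₁ c₂) :
    ∃ a b : ℝ, 0 ≤ a ∧ 0 ≤ b ∧ c₁ = c₂ * (a + b) ∧ c₀ = c₂ * (a * b) := by
  have hsum : 0 ≤ c₁ / c₂ := by
    rcases hs with ⟨_, h1, h2⟩ | ⟨_, h1, h2⟩
    · exact div_nonneg h1 h2
    · exact div_nonneg_of_nonpos h1 h2
  have hprod : 0 ≤ c₀ / c₂ := by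
    rcases hs with ⟨h1, _, h2⟩ | ⟨h1, _, h2⟩
    · exact div_nonneg h1 h2
    · exact div_nonneg_of_nonpos h1 h2
  have hd' : 0 ≤ (c₁ / c₂) ^ 2 - 4 * (c₀ / c₂) := by
    have : (c₁ / c₂) ^ 2 - 4 * (c₀ / c₂) = 4 * (c₁ ^ 2 * (1 / 4) - c₀ * c₂) / c₂ ^ 2 := by
      field_simp
    rw [this]
    positivity
  have e1 : c₁ = c₂ * (c₁ / c₂) := by field_simp
  have e0 : c₀ = c₂ * (c₀ / c₂) := by field_simp
  set u := c₁ / c₂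
  set v := c₀ / c₂
  have hq := Real.sq_sqrt hd'
  have hq0 := Real.sqrt_nonneg (u ^ 2 - 4 * v)
  have hle : √(u ^ 2 - 4 * v) ≤ u := Real.sqrt_le_iff.2 ⟨hsum, by linarith⟩
  -- The roots of `t² - u t + v`.
  refine ⟨(u + √(u ^ 2 - 4 * v)) / 2, (u - √(u ^ 2 - 4 * v)) / 2, by linarith, by linarith, ?_, ?_⟩
  · rw [e1]; ring
  · rw [e0]; linear_combination (c₂ / 4) * hq

theorem Multiset.sum_map_mul_inv_sub_sq (s : Multiset ℂ) (c z : ℂ) :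
    (s.map fun a => (c * (z - a)⁻¹) ^ 2).sum = c ^ 2 * (s.map fun a => (z - a)⁻¹ ^ 2).sum := by
  simp only [mul_pow, Multiset.sum_map_mul_left]

/-- The factor `Im z` makes one rotation serve both half-planes: the real part is `(Im z)² / |z -
a|²`. -/
theorem Complex.re_I_mul_im_mul_inv (z : ℂ) (a : ℝ) (hz : z.im ≠ 0) :
    0 < (Complex.I * z.im * (z - a)⁻¹).re := by
  have hne : z - a ≠ 0 := fun h => hz (by simpa using congrArg Complex.im h)
  have : (Complex.I * z.im * (z - a)⁻¹).re = z.im ^ 2 / Complex.normSq (z - a) := by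
    simp [Complex.mul_re, Complex.inv_im]
    ring
  rw [this]
  have := Complex.normSq_pos.2 hne
  positivity

theorem preservesHyperbolicity_eulerOp {r a b c : ℝ} (ha : 0 ≤ a) (hb : 0 ≤ b) (hc : c ≠ 0) :
    PreservesHyperbolicity (eulerOp r (c * (a * b)) (c * (a + b)) c) := by
  rintro f (rfl | hf)
  · exact Or.inl (map_zero _)
  rw [IsHyperbolic, or_iff_not_imp_left]
  intro hT z hz
  by_contra him
  apply hT
  have hf0 : f ≠ 0 := by rintro rfl; simp at hT
  have hmap : f.map (algebraMap ℝ ℂ) ≠ 0 := (Polynomial.map_ne_zero_iff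
    (algebraMap ℝ ℂ).injective).2 hf0
  set s := (f.map (algebraMap ℝ ℂ)).roots with hs
  have hsreal : ∀ w ∈ s, w.im = 0 := fun w hw =>
    hf w (by simpa [aeval_def, eval_map] using (mem_roots hmap).1 hw)
  have hfac := (IsAlgClosed.splits (f.map (algebraMap ℝ ℂ))).eq_prod_roots
  have hcard : s.card = f.natDegree := by
    rw [← natDegree_map (algebraMap ℝ ℂ)]
    exact (IsAlgClosed.splits (f.map (algebraMap ℝ ℂ))).natDegree_eq_card_roots.symm
  have hzs : z ∉ s := fun h => him (hsreal z h)
  obtain ⟨h1, h2⟩ := Polynomial.eval_derivative_multiset_prod_X_sub_C s z hzs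
  have hFz : aeval z f ≠ 0 := fun h => him (hf z h)
  have ev : ∀ g : ℝ[X], aeval z g = (g.map (algebraMap ℝ ℂ)).eval z := fun g => by
    rw [aeval_def, eval_map]
  rw [← hs] at hfac
  have e0 : aeval z f = (f.map (algebraMap ℝ ℂ)).leadingCoeff *
      (s.map fun a => X - C a).prod.eval z := by
    rw [ev]; conv_lhs => rw [hfac]
    rw [eval_mul, eval_C]
  have e1 : aeval z (derivative f) = aeval z f * (s.map fun a => (z - a)⁻¹).sum := by
    rw [e0, ev, ← derivative_map]; conv_lhs => rw [hfac]
    rw [derivative_C_mul, eval_mul, eval_C, h1, mul_assoc]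
  have e2 : aeval z (derivative (derivative f)) = aeval z f *
      ((s.map fun a => (z - a)⁻¹).sum ^ 2 - (s.map fun a => (z - a)⁻¹ ^ 2).sum) := by
    rw [e0, ev, ← derivative_map, ← derivative_map]; conv_lhs => rw [hfac]
    rw [derivative_C_mul, derivative_C_mul, eval_mul, eval_C, h2, mul_assoc]
  have hzr : z - r ≠ 0 := fun h => him (by simpa using congrArg Complex.im h)
  set k : ℂ := Complex.I * z.im with hk
  set S := (s.map fun a => (z - a)⁻¹).sum with hS
  have hmain : (S + a * (z - r)⁻¹) * (S + b * (z - r)⁻¹) = (s.map fun a => (z - a)⁻¹ ^ 2).sum := by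
    rw [eulerOp, diffOp_apply] at hz
    simp only [map_add, map_mul, map_pow, map_sub, aeval_X, aeval_C, e1, e2,
      Complex.coe_algebraMap] at hz
    have hc' : (c : ℂ) ≠ 0 := by exact_mod_cast hc
    have : (c * aeval z f * (z - r) ^ 2) * ((S + a * (z - r)⁻¹) * (S + b * (z - r)⁻¹)
        - (s.map fun a => (z - a)⁻¹ ^ 2).sum) = 0 := by
      rw [← hz]
      field_simp
      ring
    have := (mul_eq_zero.1 this).resolve_left (by positivity)
    linear_combination this
  have hre := Complex.re_I_mul_im_mul_inv z r him
  have hsc : ∀ d : ℝ, (k * (d * (z - r)⁻¹)).re = d * (k * (z - r)⁻¹).re := fun d => by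
    rw [← Complex.re_ofReal_mul]; ring_nf
  have key := Complex.eq_zero_or_card_eq_one_of_mul_eq_sum_sq (s.map fun a => k * (z - a)⁻¹)
    (by
      intro w hw
      obtain ⟨x, hx, rfl⟩ := Multiset.mem_map.1 hw
      have hx' : x = (x.re : ℂ) := Complex.ext rfl (by simpa using hsreal x hx)
      rw [hx']
      exact Complex.re_I_mul_im_mul_inv z x.re him)
    (k * (a * (z - r)⁻¹)) (k * (b * (z - r)⁻¹))
    (by rw [hsc]; positivity) (by rw [hsc]; positivity)
    (by
      rw [Multiset.map_map, Multiset.sum_map_mul_left, ← hS]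
      simp only [Function.comp_def]
      rw [Multiset.sum_map_mul_inv_sub_sq, ← hmain]
      ring)
  -- Either `f` is constant, or `f` is linear with `a = b = 0`, so that `T = c (x - r)² D²` kills
  -- it.
  rcases key with h0 | ⟨h0, hp, hq⟩
  · have hd : f.natDegree = 0 := by rw [← hcard, Multiset.map_eq_zero.1 h0]; rfl
    obtain ⟨x, rfl⟩ := natDegree_eq_zero.1 hd
    simp only [eulerOp, diffOp_apply, derivative_C, derivative_zero, mul_zero, zero_add, ← C_mul,
      aeval_C, Complex.coe_algebraMap, Complex.ofReal_eq_zero] at hz ⊢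
    rw [hz, C_0]
  · rw [hsc] at hp hq
    obtain rfl : a = 0 := (mul_eq_zero.1 hp).resolve_right hre.ne'
    obtain rfl : b = 0 := (mul_eq_zero.1 hq).resolve_right hre.ne'
    have hd : f.natDegree = 1 := by rw [← hcard, ← h0, Multiset.card_map]
    have : derivative (derivative f) = 0 := by
      have := iterate_derivative_eq_zero (p := f) (x := 2) (by omega)
      simpa using this
    simp [eulerOp, diffOp_apply, this]

/-! ### Necessity -/

theorem eulerEigenvalue_mul_nonneg {r c₀ c₁ c₂ : ℝ}
    (h : PreservesHyperbolicity (eulerOp r c₀ c₁ c₂)) (k : ℕ) :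
    0 ≤ eulerEigenvalue c₀ c₁ c₂ k * eulerEigenvalue c₀ c₁ c₂ (k + 2) := by
  by_contra! hneg
  have hf : IsHyperbolic ((X - C r) ^ (k + 2) - (X - C r) ^ k) := by
    right
    intro z hz
    simp only [map_sub, map_pow, aeval_X, aeval_C, Complex.coe_algebraMap] at hz
    have hz' : (z - r) ^ k * ((z - r - 1) * (z - r + 1)) = 0 := by rw [← hz]; ring
    rcases mul_eq_zero.1 hz' with hz' | hz'
    · simpa using congrArg Complex.im (eq_zero_of_pow_eq_zero hz')
    · rcases mul_eq_zero.1 hz' with hz' | hz'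
      · simpa using congrArg Complex.im hz'
      · simpa using congrArg Complex.im hz'
  have hT := h _ hf
  rw [map_sub, eulerOp_X_sub_C_pow, eulerOp_X_sub_C_pow] at hT
  set p := eulerEigenvalue c₀ c₁ c₂ k
  set q := eulerEigenvalue c₀ c₁ c₂ (k + 2)
  have hq0 : q ≠ 0 := by rintro hq; simp [hq] at hneg
  have hpos : 0 < -p / q := by
    rw [show -p / q = -(p * q) / q ^ 2 by field_simp]
    have : 0 < -(p * q) := by linarith
    positivity
  rcases hT with hT | hT
  -- Vanishing of `T f` would force `p = q`, hence `p q ≥ 0`.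
  · have := congrArg (eval (r + 1)) hT
    simp at this
    rw [sub_eq_zero.1 this] at hneg
    exact (mul_self_nonneg p).not_gt hneg
  · have hy : (((√(-p / q) : ℝ) : ℂ)) ^ 2 = -p / q := by
      rw [← Complex.ofReal_pow, Real.sq_sqrt hpos.le]; push_cast; rfl
    -- A nonreal zero of the factor `q (x - r)² - p` of `T f`.
    have := hT (r + Complex.I * (√(-p / q) : ℝ)) (by
      simp only [map_sub, map_mul, map_pow, aeval_X, aeval_C, Complex.coe_algebraMap,
        add_sub_cancel_left]
      have hq' : (q : ℂ) ≠ 0 := by exact_mod_cast hq0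
      rw [pow_add, mul_pow Complex.I _ 2, hy, Complex.I_sq]
      field_simp
      ring)
    simp [Real.sqrt_eq_zero', not_le.2 hpos] at this

theorem discrim_nonneg_of_isHyperbolic_quadratic_mul {r A B c : ℝ} {g : ℝ[X]}
    (hg : g.eval r ≠ 0)
    (h : IsHyperbolic (g * (C A * (X - C r) ^ 2 + C B * (X - C r) + C c))) :
    0 ≤ B ^ 2 - 4 * A * c := by
  by_contra! hneg
  have hA : A ≠ 0 := by rintro rfl; nlinarith [sq_nonneg B]
  have hc : c ≠ 0 := by rintro rfl; nlinarith [sq_nonneg B]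
  rcases h with h | h
  · have := congrArg (eval r) h
    simp [hg, hc] at this
  · have hpos : 0 < -(B ^ 2 - 4 * A * c) := by linarith
    set y := √(-(B ^ 2 - 4 * A * c)) with hy
    have hyp : 0 < y := Real.sqrt_pos.2 hpos
    have hy2 : (y : ℂ) ^ 2 = -(B ^ 2 - 4 * A * c) := by
      exact_mod_cast Real.sq_sqrt hpos.le
    have hA' : (A : ℂ) ≠ 0 := by exact_mod_cast hA
    have := h (r + (-B / (2 * A) : ℝ) + Complex.I * (y / (2 * A) : ℝ)) (by
      simp only [map_add, map_sub, map_mul, map_pow, aeval_X, aeval_C, Complex.coe_algebraMap]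
      apply mul_eq_zero_of_right
      push_cast
      field_simp
      linear_combination Complex.I ^ 2 * hy2 + (4 * A * c - B ^ 2 : ℂ) * Complex.I_sq)
    rw [Complex.add_im, Complex.add_im, Complex.ofReal_im, Complex.ofReal_im, Complex.I_mul_im,
      Complex.ofReal_re, zero_add, zero_add] at this
    exact (div_ne_zero hyp.ne' (mul_ne_zero two_ne_zero hA)) this

theorem discrim_eulerOp_X_sub_C_add_one_pow {r c₀ c₁ c₂ : ℝ}
    (h : PreservesHyperbolicity (eulerOp r c₀ c₁ c₂)) (m : ℕ) :
    0 ≤ ((m : ℝ) + 2) * (c₁ ^ 2 - 4 * c₀ * c₂) + 4 * c₀ * c₂ := by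
  have hf : IsHyperbolic ((X - C (r - 1)) ^ (m + 2)) := by
    right
    intro z hz
    simp only [map_sub, map_pow, aeval_X, aeval_C, Complex.coe_algebraMap] at hz
    simpa using congrArg Complex.im (pow_eq_zero_iff (by omega) |>.1 hz)
  have hT := h _ hf
  have e : eulerOp r c₀ c₁ c₂ ((X - C (r - 1)) ^ (m + 2)) = (X - C (r - 1)) ^ m *
      (C (c₂ * ((m + 2) * (m + 1)) + c₁ * (m + 2) + c₀) * (X - C r) ^ 2
        + C (c₁ * (m + 2) + 2 * c₀) * (X - C r) + C c₀) := by
    rw [eulerOp, diffOp_apply, derivative_X_sub_C_pow, derivative_C_mul, Nat.add_succ_sub_one,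
      derivative_X_sub_C_pow]
    simp only [map_add, map_mul, map_sub, map_natCast, map_ofNat, map_one, Nat.add_succ_sub_one,
      Nat.cast_add, Nat.cast_one, Nat.cast_ofNat, add_zero]
    ring
  rw [e] at hT
  have := discrim_nonneg_of_isHyperbolic_quadratic_mul (by simp) hT
  have hm : (0 : ℝ) < m + 2 := by positivity
  refine nonneg_of_mul_nonneg_right (a := (m : ℝ) + 2) (le_of_le_of_eq this ?_) hm
  ring

/-- As `m` grows, the term linear in `m` dominates the preceding bound. -/
theorem discrim_nonneg_of_preservesHyperbolicity {r c₀ c₁ c₂ : ℝ}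
    (h : PreservesHyperbolicity (eulerOp r c₀ c₁ c₂)) : 0 ≤ c₁ ^ 2 - 4 * c₀ * c₂ := by
  by_contra! hneg
  obtain ⟨m, hm⟩ := exists_nat_gt (4 * c₀ * c₂ / -(c₁ ^ 2 - 4 * c₀ * c₂))
  rw [div_lt_iff₀ (by linarith)] at hm
  nlinarith [discrim_eulerOp_X_sub_C_add_one_pow h m]

theorem eulerEigenvalue_nonneg {c₀ c₁ c₂ : ℝ} (hc₂ : 0 < c₂)
    (h : ∀ k, 0 ≤ eulerEigenvalue c₀ c₁ c₂ k * eulerEigenvalue c₀ c₁ c₂ (k + 2)) (k : ℕ) :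
    0 ≤ eulerEigenvalue c₀ c₁ c₂ k := by
  by_contra! hk
  -- Eigenvalues are eventually nonnegative, so a negative one is followed by a sign change;
  -- convexity in `n` (second difference `2 c₂`) then makes the next one positive, contradicting `h
  -- K`.
  obtain ⟨K, hK, hK1⟩ : ∃ K, eulerEigenvalue c₀ c₁ c₂ K < 0 ∧
      0 ≤ eulerEigenvalue c₀ c₁ c₂ (K + 1) := by
    by_contra! hcon
    have hall : ∀ n, eulerEigenvalue c₀ c₁ c₂ (k + n) < 0 := fun n => by
      induction n with
      | zero => exact hk
      | succ n ih => exact hcon _ ih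
    obtain ⟨n, hn⟩ := exists_nat_gt ((|c₁| + |c₀|) / c₂)
    rw [div_lt_iff₀ hc₂] at hn
    have hlt := hall (n + 1)
    simp only [eulerEigenvalue] at hlt
    push_cast at hlt
    have hk0 : (0 : ℝ) ≤ k := k.cast_nonneg
    have hn0 : (0 : ℝ) ≤ n := n.cast_nonneg
    have h1 : |c₀| ≤ c₂ * (k + n) + c₁ := by nlinarith [neg_abs_le c₁]
    nlinarith [neg_abs_le c₀, mul_nonneg (add_nonneg hk0 hn0) ((abs_nonneg c₀).trans h1)]
  have h2 : 0 < eulerEigenvalue c₀ c₁ c₂ (K + 2) := by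
    have : eulerEigenvalue c₀ c₁ c₂ (K + 2) = 2 * eulerEigenvalue c₀ c₁ c₂ (K + 1)
        - eulerEigenvalue c₀ c₁ c₂ K + 2 * c₂ := by
      simp only [eulerEigenvalue]
      push_cast
      ring
    linarith
  nlinarith [h K]

/-- If `c₁ < 0`, the quadratic `λ` in `n` has discriminant `(c₁² - 4c₀c₂) + c₂² - 2c₁c₂ > c₂²`, so
its roots are more than `1` apart. The ceiling below lies within `1/2` of its vertex, hence strictly
between the roots. -/
theorem nonneg_of_eulerEigenvalue_nonneg {c₀ c₁ c₂ : ℝ} (hc₂ : 0 < c₂)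
    (hd : 0 ≤ c₁ ^ 2 - 4 * c₀ * c₂) (h : ∀ k, 0 ≤ eulerEigenvalue c₀ c₁ c₂ k) : 0 ≤ c₁ := by
  by_contra! hc₁
  have hb : 0 ≤ -c₁ / (2 * c₂) := div_nonneg (by linarith) (by linarith)
  have h1 := Nat.le_ceil (-c₁ / (2 * c₂))
  have h2 := Nat.ceil_lt_add_one hb
  have hk := h ⌈-c₁ / (2 * c₂)⌉₊
  set k := ⌈-c₁ / (2 * c₂)⌉₊
  rw [div_le_iff₀ (by linarith)] at h1
  rw [← sub_lt_iff_lt_add, lt_div_iff₀ (by linarith)] at h2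
  have h3 : 0 ≤ (k * (2 * c₂) + c₁) * (2 * c₂ - (k * (2 * c₂) + c₁)) :=
    mul_nonneg (by linarith) (by linarith)
  have h4 := mul_nonneg hc₂.le hk
  simp only [eulerEigenvalue] at h4
  nlinarith [mul_pos hc₂ (neg_pos.2 hc₁)]

theorem nonneg_of_eulerEigenvalue_mul_nonneg {c₀ c₁ c₂ : ℝ} (hc₂ : 0 < c₂)
    (hd : 0 ≤ c₁ ^ 2 - 4 * c₀ * c₂)
    (h : ∀ k, 0 ≤ eulerEigenvalue c₀ c₁ c₂ k * eulerEigenvalue c₀ c₁ c₂ (k + 2)) :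
    0 ≤ c₀ ∧ 0 ≤ c₁ := by
  have h' := eulerEigenvalue_nonneg hc₂ h
  exact ⟨by simpa [eulerEigenvalue] using h' 0, nonneg_of_eulerEigenvalue_nonneg hc₂ hd h'⟩

theorem sameSign_of_preservesHyperbolicity {r c₀ c₁ c₂ : ℝ} (hc₂ : c₂ ≠ 0)
    (h : PreservesHyperbolicity (eulerOp r c₀ c₁ c₂)) : SameSign c₀ c₁ c₂ := by
  have hd := discrim_nonneg_of_preservesHyperbolicity h
  have hp := eulerEigenvalue_mul_nonneg h
  rcases hc₂.lt_or_gt with hc | hc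
  -- Negating all coefficients preserves the discriminant and the eigenvalue products.
  · obtain ⟨h0, h1⟩ := nonneg_of_eulerEigenvalue_mul_nonneg (c₀ := -c₀) (c₁ := -c₁) (c₂ := -c₂)
      (by linarith) (by linarith) (fun k => (hp k).trans_eq (by simp only [eulerEigenvalue]; ring))
    exact Or.inr ⟨by linarith, by linarith, hc.le⟩
  · obtain ⟨h0, h1⟩ := nonneg_of_eulerEigenvalue_mul_nonneg hc hd hp
    exact Or.inl ⟨h0, h1, hc.le⟩

theorem mainTheorem5 (r c₀ c₁ c₂ : ℝ) (hc₂ : c₂ ≠ 0) (Q₀ Q₁ Q₂ : ℝ[X])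
    (hQ₀ : Q₀ = Polynomial.C c₀)
    (hQ₁ : Q₁ = Polynomial.C c₁ * (Polynomial.X - Polynomial.C r))
    (hQ₂ : Q₂ = Polynomial.C c₂ * (Polynomial.X - Polynomial.C r) ^ 2) :
    (0 ≤ c₁ ^ 2 * (1 / 4) - c₀ * c₂ ∧ SameSign c₀ c₁ c₂) ↔
      PreservesHyperbolicity (diffOp Q₂ Q₁ Q₀) := by
  subst hQ₀ hQ₁ hQ₂
  constructor
  · rintro ⟨hd, hs⟩
    obtain ⟨a, b, ha, hb, rfl, rfl⟩ := exists_factor_of_sameSign hc₂ hd hs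
    exact preservesHyperbolicity_eulerOp ha hb hc₂
  · intro h
    have hd := discrim_nonneg_of_preservesHyperbolicity (r := r) h
    exact ⟨by linarith, sameSign_of_preservesHyperbolicity (r := r) hc₂ h⟩
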